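/- Let $d\in\mathbb{N}$, let $X_1,\dots,X_d$ be real random variables on a probability space $(\Omega,\mathcal F,\mathbb P)$, with no integrability assumption. Call a pair $(U,V)$ of random variables on one probability space comonotonic if there are a real random variable $Z$ on it and increasing (not necessarily strictly) functions $f,g:\mathbb{R}\to\mathbb{R}$ with $U=f(Z)$ and $V=g(Z)$ almost surely, and counter-monotonic if $(U,-V)$ is comonotonic. Let $(X_1^{\rm ct},\dots,X_d^{\rm ct})$ be a counter-monotonic version of $(X_1,\dots,X_d)$, that is, a random vector, on the same or on another probability space, such that $(X_i^{\rm ct},X_j^{\rm ct})$ is counter-monotonic for all $i\neq j$ and $X_i^{\rm ct}$ has the same distribution as $X_i$ for every $i$ (if $d\ge 3$, such a version need not exist; its existence is assumed). Then $$X_1^{\rm ct}+\dots+X_d^{\rm ct}\ \le_{\rm cx}\ X_1+\dots+X_d ,$$ where $S\le_{\rm cx}T$ means that $\mathbb{E}[u(S)]\le\mathbb{E}[u(T)]$ in $[-\infty,\infty]$ for every convex function $u:\mathbb{R}\to\mathbb{R}$ for which both expectations are well-defined, the expectation $\mathbb{E}[W]=\mathbb{E}[W_+]-\mathbb{E}[W_-]$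 being well-defined if $\mathbb{E}[W_+]<\infty$ or $\mathbb{E}[W_-]<\infty$. -/

import Mathlib

open MeasureTheory ProbabilityTheory
open scoped ENNReal

namespace CxOrder

/-- `𝔼[Z₊]`, as an element of `[0, ∞]`. -/
noncomputable def expPos {Ω : Type*} [MeasurableSpace Ω] (P : Measure Ω) (Z : Ω → ℝ) : ℝ≥0∞ :=
  ∫⁻ ω, ENNReal.ofReal (max (Z ω) 0) ∂P

/-- `𝔼[Z₋]`, with `z₋ = max (-z) 0`, as an element of `[0, ∞]`. -/
noncomputable def expNeg {Ω : Type*} [MeasurableSpace Ω] (P : Measure Ω) (Z : Ω → ℝ) : ℝ≥0∞ :=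
  ∫⁻ ω, ENNReal.ofReal (max (-Z ω) 0) ∂P

/-- The expectation of `Z` is well-defined: `𝔼[Z₊] < ∞` or `𝔼[Z₋] < ∞`. -/
def ExpWellDefined {Ω : Type*} [MeasurableSpace Ω] (P : Measure Ω) (Z : Ω → ℝ) : Prop :=
  expPos P Z < ∞ ∨ expNeg P Z < ∞

/-- The expectation `𝔼[Z] = 𝔼[Z₊] - 𝔼[Z₋]` with values in `[-∞, ∞]`; meaningful only
when it is well-defined. -/
noncomputable def expect {Ω : Type*} [MeasurableSpace Ω] (P : Measure Ω) (Z : Ω → ℝ) : EReal :=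
  (expPos P Z : EReal) - (expNeg P Z : EReal)

/-- Convex order `X ≤_cx Y`: `𝔼[u(X)] ≤ 𝔼[u(Y)]` for all convex `u : ℝ → ℝ` for which both
expectations are well-defined (possibly infinite). -/
def ConvexOrder {Ω Ω' : Type*} [MeasurableSpace Ω] [MeasurableSpace Ω']
    (P : Measure Ω) (P' : Measure Ω') (X : Ω → ℝ) (Y : Ω' → ℝ) : Prop :=
  ∀ u : ℝ → ℝ, ConvexOn ℝ Set.univ u →
    ExpWellDefined P (fun ω => u (X ω)) → ExpWellDefined P' (fun ω => u (Y ω)) →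
      expect P (fun ω => u (X ω)) ≤ expect P' (fun ω => u (Y ω))

/-- `(X, Y)` is comonotonic: almost surely `X = f(Z)` and `Y = g(Z)` for some random variable
`Z` and increasing (not necessarily strictly) functions `f`, `g`. -/
def Comonotonic {Ω : Type*} [MeasurableSpace Ω] (P : Measure Ω) (X Y : Ω → ℝ) : Prop :=
  ∃ (Z : Ω → ℝ) (f g : ℝ → ℝ), Measurable Z ∧ Monotone f ∧ Monotone g ∧
    (∀ᵐ ω ∂P, X ω = f (Z ω)) ∧ (∀ᵐ ω ∂P, Y ω = g (Z ω))

/-- `(X, Y)` is counter-monotonic: `(X, -Y)` is comonotonic. -/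
def CounterMonotonic {Ω : Type*} [MeasurableSpace Ω] (P : Measure Ω) (X Y : Ω → ℝ) : Prop :=
  Comonotonic P X (fun ω => -Y ω)

/-- A random vector `V` on `(Ω', P')` is a counter-monotonic version of the random vector `X` on
`(Ω, P)`: its components are pairwise counter-monotonic, and `V i` and `X i` have the same
distribution for each `i`. -/
def IsCounterMonotonicVersion {Ω Ω' : Type*} [MeasurableSpace Ω] [MeasurableSpace Ω']
    (P' : Measure Ω') (P : Measure Ω) {d : ℕ} (V : Fin d → Ω' → ℝ) (X : Fin d → Ω → ℝ) : Prop :=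
  (∀ i j : Fin d, i ≠ j → CounterMonotonic P' (V i) (V j)) ∧
    ∀ i : Fin d, IdentDistrib (V i) (X i) P' P

end CxOrder

/-! The proof is Kantorovich duality. If potentials satisfy `∑ aᵢ(xᵢ) + κ ≤ u(∑ xᵢ)`, with equality
almost surely along the counter-monotonic vector, then integrating gives the inequality, because the
left side sees only the marginals. Potentials come from the shape of the support
(`PairwiseAntitone.classification`): either at most two coordinates vary, or the support, possibly
after negation, is a star, where at most one coordinate exceeds a base point `m`. On a star,
superadditivity of the increments of `u` gives explicit potentials (`convexOrder_of_lowerStar`). For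
two coordinates, `exists_potentials` integrates the right derivative of `u` along a decreasing curve
through the support. Without integrability, the summands are truncated so that the truncated sum
stays between a constant and the full sum; convexity then controls both parts of `u`, and the
inequality passes to the limit (`expect_le_of_truncated_potentials`). -/

namespace CxOrder

/-! ### Geometry of pairwise antitone sets -/

/-- Any two vectors of `D` are ordered in opposite directions in any two distinct coordinates. -/
def PairwiseAntitone {ι : Type*} (D : Set (ι → ℝ)) : Prop :=
  ∀ x ∈ D, ∀ y ∈ D, ∀ i j, i ≠ j → x i < y i → y j ≤ x j

/-- Every vector of `D` dominates `m`, and exceeds it in at most one coordinate. -/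
def IsLowerStar {ι : Type*} (D : Set (ι → ℝ)) (m : ι → ℝ) : Prop :=
  ∀ x ∈ D, (∀ i, m i ≤ x i) ∧ ∀ i j, i ≠ j → x i = m i ∨ x j = m j

lemma PairwiseAntitone.neg {ι : Type*} {D : Set (ι → ℝ)} (hD : PairwiseAntitone D) :
    PairwiseAntitone {x | -x ∈ D} := by
  intro x hx y hy i j hij h
  have := hD _ hy _ hx i j hij (by simpa using h)
  simpa using this

/-- Given two coordinates, one of the three spikes equals `m` in both, so a vector exceeding `m` in
one cannot exceed it in the other. A vector below `m` somewhere would, against the spikes, exceed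
`m` in at least two of `i`, `j`, `k`. -/
lemma isLowerStar_of_three {ι : Type*} {D : Set (ι → ℝ)} (hD : PairwiseAntitone D)
    {i j k : ι} (hij : i ≠ j) (hik : i ≠ k) (hjk : j ≠ k) {m x y z : ι → ℝ}
    (hx : x ∈ D) (hy : y ∈ D) (hz : z ∈ D)
    (hxi : m i < x i) (hyj : m j < y j) (hzk : m k < z k)
    (hxm : ∀ l, l ≠ i → x l = m l) (hym : ∀ l, l ≠ j → y l = m l)
    (hzm : ∀ l, l ≠ k → z l = m l) : IsLowerStar D m := by
  -- two coordinates cannot both exceed `m`: compare with the spike in a third direction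
  have key : ∀ w ∈ D, ∀ p q r, p ≠ q → p ≠ r → q ≠ r → ∀ s ∈ D,
      (∀ l, l ≠ r → s l = m l) → m p < w p → w q ≤ m q := by
    intro w hw p q r hpq hpr hqr s hs hsm hp
    have := hD s hs w hw p q hpq (by rw [hsm p hpr]; exact hp)
    rwa [hsm q hqr] at this
  have spike : ∀ p q, ∃ r, p ≠ r ∧ q ≠ r ∧ ∃ s ∈ D, ∀ l, l ≠ r → s l = m l := by
    intro p q
    by_cases h1 : p ≠ i ∧ q ≠ i
    · exact ⟨i, h1.1, h1.2, x, hx, hxm⟩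
    by_cases h2 : p ≠ j ∧ q ≠ j
    · exact ⟨j, h2.1, h2.2, y, hy, hym⟩
    refine ⟨k, ?_, ?_, z, hz, hzm⟩ <;> grind
  have two : ∀ w ∈ D, ∀ p q, p ≠ q → m p < w p → w q ≤ m q := by
    intro w hw p q hpq hp
    obtain ⟨r, hpr, hqr, s, hs, hsm⟩ := spike p q
    exact key w hw p q r hpq hpr hqr s hs hsm hp
  have low : ∀ w ∈ D, ∀ l, m l ≤ w l := by
    intro w hw l
    by_contra! hl
    have up : ∀ r s, s ∈ D → (∀ l, l ≠ r → s l = m l) → m r < s r → l ≠ r → m r < w r := by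
      intro r s hs hsm hr hlr
      have := hD w hw s hs l r hlr (by rw [hsm l hlr]; exact hl)
      exact hr.trans_le this
    have hi := up i x hx hxm hxi
    have hj := up j y hy hym hyj
    have hk := up k z hz hzm hzk
    have h1 := two w hw i j hij
    have h2 := two w hw i k hik
    have h3 := two w hw j k hjk
    grind
  refine fun w hw => ⟨low w hw, fun p q hpq => ?_⟩
  have h1 := low w hw p
  have h2 := low w hw q
  rcases h1.lt_or_eq with h | h
  · exact Or.inr (le_antisymm (two w hw p q hpq h) h2)
  · exact Or.inl h.symm

lemma exists_isLowerStar {ι : Type*} {D : Set (ι → ℝ)} (hD : PairwiseAntitone D)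
    {i j k : ι} (hij : i ≠ j) (hik : i ≠ k) (hjk : j ≠ k) {x y z : ι → ℝ}
    (hx : x ∈ D) (hy : y ∈ D) (hz : z ∈ D) (hi : y i < x i) (hj : x j < y j) (hk : x k < z k) :
    ∃ m, IsLowerStar D m := by
  classical
  have hxy : ∀ l, l ≠ i → l ≠ j → x l = y l := fun l hli hlj => le_antisymm
    (hD y hy x hx i l hli.symm hi)
    (hD x hx y hy j l hlj.symm hj)
  have hyk : y k < z k := by rwa [← hxy k hik.symm hjk.symm]
  have hzi : z i ≤ y i := hD y hy z hz k i hik.symm hyk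
  have hzj : z j ≤ x j := hD x hx z hz k j hjk.symm hk
  have hzx : ∀ l, l ≠ i → l ≠ k → z l = x l := fun l hli hlk => le_antisymm
    (hD x hx z hz k l hlk.symm hk) (hD z hz x hx i l hli.symm (hzi.trans_lt hi))
  have hzy : ∀ l, l ≠ j → l ≠ k → z l = y l := fun l hlj hlk => le_antisymm
    (hD y hy z hz k l hlk.symm hyk) (hD z hz y hy j l hlj.symm (hzj.trans_lt hj))
  -- The base point is the coordinatewise minimum of `x` and `y`: they differ only at `i` and `j`.
  refine ⟨Function.update x i (y i), isLowerStar_of_three hD hij hik hjk hx hy hz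
    (by simpa using hi) (by simpa [hij.symm] using hj) (by simpa [hik.symm] using hk) ?_ ?_ ?_⟩
  · intro l hl; simp [hl]
  · intro l hl
    by_cases h : l = i
    · subst h; simp
    · simp [h, hxy l h hl]
  · intro l hl
    by_cases h : l = i
    · subst h; simp [hzy l hij hl]
    · simp [h, hzx l h hl]

/-- A pairwise antitone set with three non-constant coordinates is a star. -/
lemma PairwiseAntitone.star_of_three {ι : Type*} {D : Set (ι → ℝ)} (hD : PairwiseAntitone D)
    {k₁ k₂ k₃ : ι} (h12 : k₁ ≠ k₂) (h13 : k₁ ≠ k₃) (h23 : k₂ ≠ k₃)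
    (h1 : ∃ x ∈ D, ∃ y ∈ D, x k₁ ≠ y k₁) (h2 : ∃ x ∈ D, ∃ y ∈ D, x k₂ ≠ y k₂)
    (h3 : ∃ x ∈ D, ∃ y ∈ D, x k₃ ≠ y k₃) :
    (∃ m, IsLowerStar D m) ∨ ∃ m, IsLowerStar {x | -x ∈ D} m := by
  by_cases hA : ∃ i j, i ≠ j ∧ ∃ x ∈ D, ∃ y ∈ D, y i < x i ∧ x j < y j
  · obtain ⟨i, j, hij, x, hx, y, hy, hi, hj⟩ := hA
    obtain ⟨k, hik, hjk, z, hz, w, hw, hzw⟩ :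
        ∃ k, i ≠ k ∧ j ≠ k ∧ ∃ x ∈ D, ∃ y ∈ D, x k ≠ y k := by
      by_cases e1 : i ≠ k₁ ∧ j ≠ k₁
      · exact ⟨k₁, e1.1, e1.2, h1⟩
      by_cases e2 : i ≠ k₂ ∧ j ≠ k₂
      · exact ⟨k₂, e2.1, e2.2, h2⟩
      refine ⟨k₃, ?_, ?_, h3⟩ <;> grind
    obtain ⟨z, hz, hzk⟩ : ∃ z ∈ D, z k ≠ x k := by
      by_cases e : z k = x k
      · exact ⟨w, hw, fun e' => hzw (e.trans e'.symm)⟩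
      · exact ⟨z, hz, e⟩
    rcases hzk.lt_or_gt with h | h
    · right
      exact exists_isLowerStar hD.neg hij.symm hjk hik (x := -x) (y := -y) (z := -z)
        (by simpa using hx) (by simpa using hy) (by simpa using hz)
        (by simpa using hj) (by simpa using hi) (by simpa using h)
    · exact Or.inl (exists_isLowerStar hD hij hik hjk hx hy hz hi hj h)
  · exfalso
    -- Now two points differ in at most one coordinate, so variation at `k₁` forces `k₂` to be
    -- constant.
    have one : ∀ x ∈ D, ∀ y ∈ D, ∀ i j, i ≠ j → x i ≠ y i → x j = y j := by
      intro x hx y hy i j hij hne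
      by_contra hne'
      rcases hne.lt_or_gt with h | h <;> rcases Ne.lt_or_gt hne' with h' | h'
      · exact absurd (hD x hx y hy i j hij h) (not_le.2 h')
      · exact hA ⟨j, i, hij.symm, x, hx, y, hy, h', h⟩
      · exact hA ⟨i, j, hij, x, hx, y, hy, h, h'⟩
      · exact absurd (hD y hy x hx i j hij h) (not_le.2 h')
    obtain ⟨x, hx, y, hy, hxy⟩ := h1
    obtain ⟨z, hz, w, hw, hzw⟩ := h2
    have e := one x hx y hy k₁ k₂ h12 hxy
    have f : ∀ v ∈ D, v k₂ = x k₂ := by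
      intro v hv
      by_contra hne
      have a := one v hv x hx k₂ k₁ h12.symm hne
      have b := one v hv y hy k₂ k₁ h12.symm (by rwa [← e])
      exact hxy (a.symm.trans b)
    exact hzw ((f z hz).trans (f w hw).symm)

lemma PairwiseAntitone.classification {ι : Type*} [Nontrivial ι] {D : Set (ι → ℝ)}
    (hD : PairwiseAntitone D) :
    (∃ i j, i ≠ j ∧ ∀ l, l ≠ i → l ≠ j → ∀ x ∈ D, ∀ y ∈ D, x l = y l) ∨
    (∃ m, IsLowerStar D m) ∨ ∃ m, IsLowerStar {x | -x ∈ D} m := by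
  by_cases h : ∃ i j, i ≠ j ∧ ∀ l, l ≠ i → l ≠ j → ∀ x ∈ D, ∀ y ∈ D, x l = y l
  · exact Or.inl h
  · right
    push Not at h
    obtain ⟨a, b, hab⟩ := exists_pair_ne ι
    obtain ⟨k₁, -, -, h1⟩ := h a b hab
    obtain ⟨c, hc⟩ := exists_ne k₁
    obtain ⟨k₂, h12, -, h2⟩ := h k₁ c hc.symm
    obtain ⟨k₃, h13, h23, h3⟩ := h k₁ k₂ h12.symm
    exact hD.star_of_three h12.symm h13.symm h23.symm h1 h2 h3

/-! ### Convex functions on the line -/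

lemma _root_.ConvexOn.continuous_of_univ {u : ℝ → ℝ} (hu : ConvexOn ℝ Set.univ u) : Continuous u :=
  continuousOn_univ.1 (hu.continuousOn isOpen_univ)

lemma _root_.ConvexOn.le_max_of_mem_uIcc {u : ℝ → ℝ} (hu : ConvexOn ℝ Set.univ u) {a b t : ℝ}
    (ht : t ∈ Set.uIcc a b) : u t ≤ max (u a) (u b) :=
  hu.le_max_of_mem_segment (Set.mem_univ _) (Set.mem_univ _) (segment_eq_uIcc a b ▸ ht)

/-- Otherwise `u` strictly drops from `a` to `b` and strictly rises from `c` to `d`; convexity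
bounds it below left of `a` and right of `d`, compactness in between. -/
lemma _root_.ConvexOn.bddBelow_or_monotone_or_antitone {u : ℝ → ℝ} (hu : ConvexOn ℝ Set.univ u) :
    (∃ M, ∀ x, M ≤ u x) ∨ Monotone u ∨ Antitone u := by
  by_cases hm : Monotone u
  · exact Or.inr (Or.inl hm)
  by_cases ha : Antitone u
  · exact Or.inr (Or.inr ha)
  left
  simp only [Monotone, Antitone, not_forall, not_le] at hm ha
  obtain ⟨a, b, hab, h1⟩ := hm
  obtain ⟨c, d, hcd, h2⟩ := ha
  have hab' : a < b := lt_of_le_of_ne hab (by rintro rfl; exact lt_irrefl _ h1)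
  have hcd' : c < d := lt_of_le_of_ne hcd (by rintro rfl; exact lt_irrefl _ h2)
  obtain ⟨M, hM⟩ := (isCompact_Icc (a := a) (b := d)).bddBelow_image
    hu.continuous_of_univ.continuousOn
  refine ⟨min M (min (u b) (u c)), fun x => ?_⟩
  by_cases hx : x ∈ Set.Icc a d
  · exact (min_le_left _ _).trans (hM ⟨x, hx, rfl⟩)
  rw [Set.mem_Icc, not_and_or, not_le, not_le] at hx
  refine (min_le_right _ _).trans ?_
  rcases hx with hx | hx
  · have := hu.le_max_of_mem_uIcc (a := x) (b := b) (t := a)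
      (Set.mem_uIcc.2 (Or.inl ⟨hx.le, hab⟩))
    rcases le_max_iff.1 this with h | h
    · exact (min_le_left _ _).trans (h1.le.trans h)
    · exact absurd h (not_le.2 h1)
  · have := hu.le_max_of_mem_uIcc (a := c) (b := x) (t := d)
      (Set.mem_uIcc.2 (Or.inl ⟨hcd, hx.le⟩))
    rcases le_max_iff.1 this with h | h
    · exact absurd h (not_le.2 h2)
    · exact (min_le_right _ _).trans (h2.le.trans h)

/-- Along a segment starting at `b`, the positive and negative parts of a convex function are
controlled, up to a constant, by their values at the other endpoint. -/
lemma _root_.ConvexOn.exists_parts_bound {u : ℝ → ℝ} (hu : ConvexOn ℝ Set.univ u) (b : ℝ) :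
    ∃ K : ℝ, 0 ≤ K ∧ ∀ s, ∀ t ∈ Set.uIcc b s,
      max (u t) 0 ≤ max (u s) 0 + K ∧ max (-u t) 0 ≤ max (-u s) 0 + K := by
  obtain ⟨K, hK⟩ : ∃ K : ℝ, ∀ s, ∀ t ∈ Set.uIcc b s, max (-u t) 0 ≤ max (-u s) 0 + K := by
    rcases hu.bddBelow_or_monotone_or_antitone with ⟨M, hM⟩ | h | h
    · refine ⟨|M|, fun s t _ => ?_⟩
      have := hM t
      have h0 := le_max_right (-u s) 0
      exact max_le (by linarith [neg_abs_le M]) (by positivity)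
    · refine ⟨|u b|, fun s t ht => ?_⟩
      have h0 := le_max_right (-u s) 0
      have h1 := le_max_left (-u s) 0
      refine max_le ?_ (by positivity)
      rcases Set.mem_uIcc.1 ht with ht | ht
      · linarith [h ht.1, neg_abs_le (u b)]
      · linarith [h ht.1, abs_nonneg (u b)]
    · refine ⟨|u b|, fun s t ht => ?_⟩
      have h0 := le_max_right (-u s) 0
      have h1 := le_max_left (-u s) 0
      refine max_le ?_ (by positivity)
      rcases Set.mem_uIcc.1 ht with ht | ht
      · linarith [h ht.2, abs_nonneg (u b)]
      · linarith [h ht.2, neg_abs_le (u b)]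
  refine ⟨max K |u b|, (abs_nonneg _).trans (le_max_right _ _), fun s t ht => ⟨?_, ?_⟩⟩
  · have h0 := le_max_right (u s) 0
    have h1 := le_max_left (u s) 0
    have h2 := le_max_right K |u b|
    refine max_le ?_ (by positivity)
    refine (hu.le_max_of_mem_uIcc ht).trans (max_le ?_ ?_)
    · linarith [le_abs_self (u b)]
    · linarith [abs_nonneg (u b)]
  · exact (hK s t ht).trans (by gcongr; exact le_max_left _ _)

lemma _root_.ConvexOn.monotone_rightDeriv_univ {u : ℝ → ℝ} (hu : ConvexOn ℝ Set.univ u) :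
    Monotone (fun x => derivWithin u (Set.Ioi x) x) := by
  have := hu.monotoneOn_rightDeriv
  rwa [interior_univ, monotoneOn_univ] at this

lemma _root_.ConvexOn.integral_rightDeriv {u : ℝ → ℝ} (hu : ConvexOn ℝ Set.univ u) (y a b : ℝ) :
    ∫ t in a..b, derivWithin u (Set.Ioi (t + y)) (t + y) = u (b + y) - u (a + y) := by
  rw [intervalIntegral.integral_comp_add_right (fun t => derivWithin u (Set.Ioi t) t)]
  exact intervalIntegral.integral_eq_sub_of_hasDeriv_right hu.continuous_of_univ.continuousOn
    (fun x _ => hu.hasDerivWithinAt_rightDeriv_of_mem_interior (by simp))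
    hu.monotone_rightDeriv_univ.intervalIntegrable

/-! ### Dual potentials for two coordinates -/

/-- Though `t + h t` need not be monotone, on `[a, b]` it stays between `a + h b` and `b + h a`. -/
lemma intervalIntegrable_monotone_comp_add_antitone {r h : ℝ → ℝ} (hr : Monotone r)
    (hh : Antitone h) (a b : ℝ) : IntervalIntegrable (fun t => r (t + h t)) volume a b := by
  wlog hab : a ≤ b generalizing a b
  · exact (this b a (le_of_not_ge hab)).symm
  rw [intervalIntegrable_iff_integrableOn_Icc_of_le hab]
  refine Measure.integrableOn_of_bounded (M := max |r (a + h b)| |r (b + h a)|) (by simp) ?_ ?_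
  · exact (hr.measurable.comp (measurable_id.add hh.measurable)).aestronglyMeasurable
  · refine (ae_restrict_mem measurableSet_Icc).mono fun t ht => ?_
    rw [Real.norm_eq_abs]
    exact abs_le_max_abs_abs (hr (by linarith [ht.1, hh ht.2])) (hr (by linarith [ht.2, hh ht.1]))

/-- Dual potentials for the transport of counter-monotonic pairs with cost `u (x + y)`. -/
lemma exists_potentials {u : ℝ → ℝ} (hu : ConvexOn ℝ Set.univ u) {N : ℝ} {D : Set (ℝ × ℝ)}
    (hDN : ∀ p ∈ D, p.1 ∈ Set.Icc (-N) N ∧ p.2 ∈ Set.Icc (-N) N)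
    (hD : ∀ p ∈ D, ∀ q ∈ D, p.1 < q.1 → q.2 ≤ p.2) :
    ∃ a b : ℝ → ℝ, Continuous a ∧ Continuous b ∧
      (∀ x ∈ Set.Icc (-N) N, ∀ y, a x + b y ≤ u (x + y)) ∧
      ∀ p ∈ D, a p.1 + b p.2 = u (p.1 + p.2) := by
  set r : ℝ → ℝ := fun x => derivWithin u (Set.Ioi x) x with hrdef
  have hr : Monotone r := hu.monotone_rightDeriv_univ
  -- `h` is a decreasing curve through `D`; inserting `N`, which bounds the second coordinates,
  -- makes the infimum one over a nonempty set.
  set S : ℝ → Set ℝ := fun t => insert N {y | ∃ x < t, (x, y) ∈ D} with hS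
  set h : ℝ → ℝ := fun t => sInf (S t) with hh
  have hSb : ∀ t, BddBelow (S t) := by
    intro t
    refine ⟨min N (-N), ?_⟩
    rintro y (rfl | ⟨x, -, hxy⟩)
    · exact min_le_left _ _
    · exact (min_le_right _ _).trans (hDN _ hxy).2.1
  have hanti : Antitone h := fun s t hst => csInf_le_csInf (hSb t) ⟨N, Or.inl rfl⟩
    (Set.insert_subset_insert fun y ⟨x, hx, hxy⟩ => ⟨x, hx.trans_le hst, hxy⟩)
  have hle : ∀ p ∈ D, ∀ t, p.1 < t → h t ≤ p.2 := fun p hp t ht =>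
    csInf_le (hSb t) (Or.inr ⟨p.1, ht, hp⟩)
  have hge : ∀ p ∈ D, ∀ t, t < p.1 → p.2 ≤ h t := by
    intro p hp t ht
    refine le_csInf ⟨N, Or.inl rfl⟩ ?_
    rintro y (rfl | ⟨x, hx, hxy⟩)
    · exact (hDN p hp).2.2
    · exact hD _ hxy _ hp (hx.trans ht)
  have hint : ∀ a b, IntervalIntegrable (fun t => r (t + h t)) volume a b :=
    intervalIntegrable_monotone_comp_add_antitone hr hanti
  have hint' : ∀ y a b, IntervalIntegrable (fun t => r (t + y)) volume a b := fun y =>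
    intervalIntegrable_monotone_comp_add_antitone hr (antitone_const (c := y))
  set a : ℝ → ℝ := fun x => ∫ t in (0 : ℝ)..x, r (t + h t) with hadef
  have ha : Continuous a := intervalIntegral.continuous_primitive hint 0
  -- `x ↦ u (x + p.2) - a x` is minimal at `p.1`, since `h` is at least `p.2` to the left of `p.1`
  -- and at most `p.2` to the right.
  have hau : ∀ p ∈ D, ∀ x, u (p.1 + p.2) - a p.1 ≤ u (x + p.2) - a x := by
    intro p hp x
    have e1 : a x - a p.1 = ∫ t in p.1..x, r (t + h t) :=
      intervalIntegral.integral_interval_sub_left (hint _ _) (hint _ _)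
    have e2 := hu.integral_rightDeriv p.2 p.1 x
    suffices H : ∫ t in p.1..x, r (t + h t) ≤ ∫ t in p.1..x, r (t + p.2) by
      have : ∫ t in p.1..x, r (t + p.2) = u (x + p.2) - u (p.1 + p.2) := e2
      linarith
    rcases le_total p.1 x with hx | hx
    · refine intervalIntegral.integral_mono_on_of_le_Ioo hx (hint _ _) (hint' _ _ _) fun t ht => ?_
      exact hr (by linarith [hle p hp t ht.1])
    · rw [intervalIntegral.integral_symm, intervalIntegral.integral_symm x]
      refine neg_le_neg ?_
      refine intervalIntegral.integral_mono_on_of_le_Ioo hx (hint' _ _ _) (hint _ _) fun t ht => ?_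
      exact hr (by linarith [hge p hp t ht.2])
  have hcont : Continuous (fun p : ℝ × ℝ => u (p.2 + p.1) - a p.2) :=
    (hu.continuous_of_univ.comp (continuous_snd.add continuous_fst)).sub (ha.comp continuous_snd)
  have hbdd : ∀ y, BddBelow ((fun x => u (x + y) - a x) '' Set.Icc (-N) N) := fun y =>
    isCompact_Icc.bddBelow_image (hcont.comp (Continuous.prodMk_right y)).continuousOn
  -- `b` is the conjugate of `a` for the cost; the infimum over a compact interval keeps it
  -- continuous.
  refine ⟨a, fun y => sInf ((fun x => u (x + y) - a x) '' Set.Icc (-N) N), ha,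
    isCompact_Icc.continuous_sInf (f := fun y x => u (x + y) - a x) hcont, ?_, ?_⟩
  · intro x hx y
    have := csInf_le (hbdd y) ⟨x, hx, rfl⟩
    simp only at this ⊢
    linarith
  · intro p hp
    have : sInf ((fun x => u (x + p.2) - a x) '' Set.Icc (-N) N) = u (p.1 + p.2) - a p.1 := by
      refine IsLeast.csInf_eq ⟨⟨p.1, (hDN p hp).1, rfl⟩, ?_⟩
      rintro _ ⟨x, -, rfl⟩
      exact hau p hp x
    simp only [this]
    ring

/-! ### Extended expectations and their limits -/

/-- The subtraction-free form of the inequality survives limits even when terms become infinite. -/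
lemma expect_le_of_cross {Ω Ω' : Type*} [MeasurableSpace Ω] [MeasurableSpace Ω']
    {P : Measure Ω} {P' : Measure Ω'} {W : Ω' → ℝ} {W' : Ω → ℝ}
    (hW : ExpWellDefined P' W) (hW' : ExpWellDefined P W')
    (h : expPos P' W + expNeg P W' ≤ expPos P W' + expNeg P' W) :
    expect P' W ≤ expect P W' := by
  unfold ExpWellDefined at hW hW'
  unfold expect
  generalize expPos P' W = a at *
  generalize expNeg P' W = b at *
  generalize expPos P W' = c at *
  generalize expNeg P W' = e at *
  by_cases hb : b = ∞
  · have ha : a ≠ ∞ := by rcases hW with h | h; exacts [h.ne, absurd hb h.ne]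
    lift a to NNReal using ha
    subst hb
    simp
  by_cases hc : c = ∞
  · have he : e ≠ ∞ := by rcases hW' with h | h; exacts [absurd hc h.ne, h.ne]
    lift e to NNReal using he
    subst hc
    simp
  have hfin : c + b ≠ ∞ := ENNReal.add_ne_top.2 ⟨hc, hb⟩
  obtain ⟨ha, he⟩ := ENNReal.add_ne_top.1 (ne_top_of_le_ne_top hfin h)
  lift a to NNReal using ha
  lift b to NNReal using hb
  lift c to NNReal using hc
  lift e to NNReal using he
  have h' : (a : ℝ) + e ≤ c + b := by exact_mod_cast h
  have : (a : ℝ) - b ≤ c - e := by linarith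
  rw [EReal.coe_nnreal_eq_coe_real, EReal.coe_nnreal_eq_coe_real, EReal.coe_nnreal_eq_coe_real,
    EReal.coe_nnreal_eq_coe_real]
  exact_mod_cast this

lemma expPos_eq {Ω : Type*} [MeasurableSpace Ω] (P : Measure Ω) (W : Ω → ℝ) :
    expPos P W = ∫⁻ ω, ENNReal.ofReal (W ω) ∂P := by
  simp only [expPos, ENNReal.ofReal_max, ENNReal.ofReal_zero, max_zero]

lemma expNeg_eq {Ω : Type*} [MeasurableSpace Ω] (P : Measure Ω) (W : Ω → ℝ) :
    expNeg P W = ∫⁻ ω, ENNReal.ofReal (-W ω) ∂P :=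
  expPos_eq P fun ω => -W ω

lemma cross_of_integral_le {Ω Ω' : Type*} [MeasurableSpace Ω] [MeasurableSpace Ω']
    {P : Measure Ω} {P' : Measure Ω'} {W : Ω' → ℝ} {W' : Ω → ℝ}
    (hW : Integrable W P') (hW' : Integrable W' P) (h : ∫ ω, W ω ∂P' ≤ ∫ ω, W' ω ∂P) :
    expPos P' W + expNeg P W' ≤ expPos P W' + expNeg P' W := by
  rw [integral_eq_lintegral_pos_part_sub_lintegral_neg_part hW,
    integral_eq_lintegral_pos_part_sub_lintegral_neg_part hW'] at h
  have f1 : ∫⁻ a, ENNReal.ofReal (W a) ∂P' ≠ ∞ := hW.lintegral_lt_top.ne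
  have f2 : ∫⁻ a, ENNReal.ofReal (W' a) ∂P ≠ ∞ := hW'.lintegral_lt_top.ne
  have f3 : ∫⁻ a, ENNReal.ofReal (-W a) ∂P' ≠ ∞ := hW.neg.lintegral_lt_top.ne
  have f4 : ∫⁻ a, ENNReal.ofReal (-W' a) ∂P ≠ ∞ := hW'.neg.lintegral_lt_top.ne
  rw [expPos_eq, expPos_eq, expNeg_eq, expNeg_eq,
    ← ENNReal.toReal_le_toReal (ENNReal.add_ne_top.2 ⟨f1, f4⟩) (ENNReal.add_ne_top.2 ⟨f2, f3⟩),
    ENNReal.toReal_add f1 f4, ENNReal.toReal_add f2 f3]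
  linarith

/-- Dominated convergence if `f` has finite integral, Fatou otherwise. -/
lemma tendsto_lintegral_of_le_add_const {Ω : Type*} [MeasurableSpace Ω] {P : Measure Ω}
    [IsFiniteMeasure P] {F : ℕ → Ω → ℝ≥0∞} {f : Ω → ℝ≥0∞} (hF : ∀ n, AEMeasurable (F n) P)
    {K : ℝ≥0∞} (hK : K ≠ ∞) (hle : ∀ n, ∀ᵐ ω ∂P, F n ω ≤ f ω + K)
    (hlim : ∀ᵐ ω ∂P, Filter.Tendsto (fun n => F n ω) Filter.atTop (nhds (f ω))) :
    Filter.Tendsto (fun n => ∫⁻ ω, F n ω ∂P) Filter.atTop (nhds (∫⁻ ω, f ω ∂P)) := by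
  by_cases hf : ∫⁻ ω, f ω ∂P = ∞
  · refine tendsto_of_le_liminf_of_limsup_le ?_ (by rw [hf]; exact le_top)
    calc ∫⁻ ω, f ω ∂P = ∫⁻ ω, Filter.liminf (fun n => F n ω) Filter.atTop ∂P :=
          lintegral_congr_ae (hlim.mono fun ω h => h.liminf_eq.symm)
      _ ≤ _ := lintegral_liminf_le' hF
  · refine tendsto_lintegral_of_dominated_convergence' (fun ω => f ω + K) hF hle ?_ hlim
    rw [lintegral_add_right _ measurable_const, lintegral_const]
    exact ENNReal.add_ne_top.2 ⟨hf, ENNReal.mul_ne_top hK (measure_ne_top _ _)⟩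

lemma tendsto_expPos {Ω : Type*} [MeasurableSpace Ω] {P : Measure Ω}
    [IsFiniteMeasure P] {V : ℕ → Ω → ℝ} {W : Ω → ℝ} (hV : ∀ n, AEMeasurable (V n) P)
    {K : ℝ} (hK : 0 ≤ K) (hle : ∀ᵐ ω ∂P, ∀ n, max (V n ω) 0 ≤ max (W ω) 0 + K)
    (hlim : ∀ᵐ ω ∂P, ∀ᶠ n in Filter.atTop, V n ω = W ω) :
    Filter.Tendsto (fun n => expPos P (V n)) Filter.atTop (nhds (expPos P W)) := by
  refine tendsto_lintegral_of_le_add_const (K := ENNReal.ofReal K)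
    (fun n => ((hV n).max aemeasurable_const).ennreal_ofReal) ENNReal.ofReal_ne_top
    (fun n => hle.mono fun ω h => ?_) (hlim.mono fun ω h => ?_)
  · rw [← ENNReal.ofReal_add (le_max_right _ _) hK]
    exact ENNReal.ofReal_le_ofReal (h n)
  · exact tendsto_const_nhds.congr' (h.mono fun n hn => by simp only [hn])

lemma tendsto_expNeg {Ω : Type*} [MeasurableSpace Ω] {P : Measure Ω}
    [IsFiniteMeasure P] {V : ℕ → Ω → ℝ} {W : Ω → ℝ} (hV : ∀ n, AEMeasurable (V n) P)
    {K : ℝ} (hK : 0 ≤ K) (hle : ∀ᵐ ω ∂P, ∀ n, max (-V n ω) 0 ≤ max (-W ω) 0 + K)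
    (hlim : ∀ᵐ ω ∂P, ∀ᶠ n in Filter.atTop, V n ω = W ω) :
    Filter.Tendsto (fun n => expNeg P (V n)) Filter.atTop (nhds (expNeg P W)) :=
  tendsto_expPos (fun n => (hV n).neg) hK hle
    (hlim.mono fun ω h => h.mono fun n hn => by simp only [hn])

/-! ### Duality by truncation -/

lemma integrable_comp_of_bounded {Ω : Type*} [MeasurableSpace Ω] {P : Measure Ω}
    [IsFiniteMeasure P] {g : ℝ → ℝ} (hg : Continuous g) {W : Ω → ℝ} (hW : AEMeasurable W P)
    {M : ℝ} (hM : ∀ ω, |W ω| ≤ M) : Integrable (fun ω => g (W ω)) P := by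
  obtain ⟨C, hC⟩ := (isCompact_Icc (a := -M) (b := M)).exists_bound_of_continuousOn
    hg.continuousOn
  exact Integrable.of_bound (hg.measurable.comp_aemeasurable hW).aestronglyMeasurable C
    (Filter.Eventually.of_forall fun ω => hC _ (abs_le.1 (hM ω)))

/-- If suitable truncations of the summands admit dual potentials that are tight along `A`, then
the expectation of a convex function of the sum of `A` is at most that of the sum of `B`. -/
lemma expect_le_of_truncated_potentials {Ω Ω' ι : Type*} [Fintype ι] [MeasurableSpace Ω]
    [MeasurableSpace Ω'] {P : Measure Ω} [IsProbabilityMeasure P] {P' : Measure Ω'}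
    [IsProbabilityMeasure P'] {A : ι → Ω' → ℝ} {B : ι → Ω → ℝ}
    (hAB : ∀ i, IdentDistrib (A i) (B i) P' P) {u : ℝ → ℝ} (hu : ConvexOn ℝ Set.univ u) {c : ℝ}
    {φ : ℕ → ι → ℝ → ℝ} (hφ : ∀ n i, Continuous (φ n i))
    (hφb : ∀ n, ∃ M : ι → ℝ, ∀ i x, |φ n i x| ≤ M i)
    (hpA : ∀ᵐ ω ∂P', ∀ n, ∑ i, φ n i (A i ω) ∈ Set.uIcc c (∑ i, A i ω))
    (hpB : ∀ᵐ ω ∂P, ∀ n, ∑ i, φ n i (B i ω) ∈ Set.uIcc c (∑ i, B i ω))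
    (hlA : ∀ᵐ ω ∂P', ∀ i, ∀ᶠ n in Filter.atTop, φ n i (A i ω) = A i ω)
    (hlB : ∀ᵐ ω ∂P, ∀ i, ∀ᶠ n in Filter.atTop, φ n i (B i ω) = B i ω)
    (hpot : ∀ n, ∃ (a : ι → ℝ → ℝ) (κ : ℝ), (∀ i, Continuous (a i)) ∧
      (∀ x : ι → ℝ, ∑ i, a i (φ n i (x i)) + κ ≤ u (∑ i, φ n i (x i))) ∧
      ∀ᵐ ω ∂P', ∑ i, a i (φ n i (A i ω)) + κ = u (∑ i, φ n i (A i ω)))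
    (hwA : ExpWellDefined P' fun ω => u (∑ i, A i ω))
    (hwB : ExpWellDefined P fun ω => u (∑ i, B i ω)) :
    expect P' (fun ω => u (∑ i, A i ω)) ≤ expect P (fun ω => u (∑ i, B i ω)) := by
  have mA : ∀ n i, AEMeasurable (fun ω => φ n i (A i ω)) P' := fun n i =>
    (hφ n i).measurable.comp_aemeasurable (hAB i).aemeasurable_fst
  have mB : ∀ n i, AEMeasurable (fun ω => φ n i (B i ω)) P := fun n i =>
    (hφ n i).measurable.comp_aemeasurable (hAB i).aemeasurable_snd
  have sA : ∀ n, AEMeasurable (fun ω => ∑ i, φ n i (A i ω)) P' := fun n =>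
    Finset.univ.aemeasurable_fun_sum fun i _ => mA n i
  have sB : ∀ n, AEMeasurable (fun ω => ∑ i, φ n i (B i ω)) P := fun n =>
    Finset.univ.aemeasurable_fun_sum fun i _ => mB n i
  have cu := hu.continuous_of_univ
  have uA : ∀ n, AEMeasurable (fun ω => u (∑ i, φ n i (A i ω))) P' := fun n =>
    cu.measurable.comp_aemeasurable (sA n)
  have uB : ∀ n, AEMeasurable (fun ω => u (∑ i, φ n i (B i ω))) P := fun n =>
    cu.measurable.comp_aemeasurable (sB n)
  have cross : ∀ n, expPos P' (fun ω => u (∑ i, φ n i (A i ω))) +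
        expNeg P (fun ω => u (∑ i, φ n i (B i ω))) ≤
      expPos P (fun ω => u (∑ i, φ n i (B i ω))) +
        expNeg P' (fun ω => u (∑ i, φ n i (A i ω))) := by
    intro n
    obtain ⟨a, κ, ha, hle, heq⟩ := hpot n
    obtain ⟨M, hM⟩ := hφb n
    have hsum : ∀ x : ι → ℝ, |∑ i, φ n i (x i)| ≤ ∑ i, M i := fun x =>
      (Finset.abs_sum_le_sum_abs _ _).trans (Finset.sum_le_sum fun i _ => hM i _)
    have iA : ∀ i, Integrable (fun ω => a i (φ n i (A i ω))) P' := fun i =>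
      integrable_comp_of_bounded (ha i) (mA n i) fun ω => hM i _
    have iB : ∀ i, Integrable (fun ω => a i (φ n i (B i ω))) P := fun i =>
      integrable_comp_of_bounded (ha i) (mB n i) fun ω => hM i _
    have jA : Integrable (fun ω => ∑ i, a i (φ n i (A i ω))) P' :=
      integrable_finsetSum _ fun i _ => iA i
    have jB : Integrable (fun ω => ∑ i, a i (φ n i (B i ω))) P :=
      integrable_finsetSum _ fun i _ => iB i
    have kA := integrable_comp_of_bounded cu (sA n) fun ω => hsum fun i => A i ω
    have kB := integrable_comp_of_bounded cu (sB n) fun ω => hsum fun i => B i ω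
    refine cross_of_integral_le kA kB ?_
    -- Tightness along `A`, then equality of the marginals, then the potential inequality along `B`.
    calc ∫ ω, u (∑ i, φ n i (A i ω)) ∂P' = ∫ ω, ((∑ i, a i (φ n i (A i ω))) + κ) ∂P' :=
          integral_congr_ae (heq.mono fun ω h => h.symm)
      _ = ∫ ω, ((∑ i, a i (φ n i (B i ω))) + κ) ∂P := by
          rw [integral_add jA (integrable_const _), integral_add jB (integrable_const _),
            integral_finsetSum _ fun i _ => iA i, integral_finsetSum _ fun i _ => iB i]
          congr 1
          · refine Finset.sum_congr rfl fun i _ => ?_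
            exact ((hAB i).comp ((ha i).comp (hφ n i)).measurable).integral_eq
          · simp
      _ ≤ ∫ ω, u (∑ i, φ n i (B i ω)) ∂P :=
          integral_mono (jB.add (integrable_const _)) kB fun ω => hle fun i => B i ω
  obtain ⟨K, hK, hb⟩ := hu.exists_parts_bound c
  have eA : ∀ᵐ ω ∂P', ∀ᶠ n in Filter.atTop, u (∑ i, φ n i (A i ω)) = u (∑ i, A i ω) :=
    hlA.mono fun ω h => (Filter.eventually_all.2 h).mono fun n hn => by simp only [hn]
  have eB : ∀ᵐ ω ∂P, ∀ᶠ n in Filter.atTop, u (∑ i, φ n i (B i ω)) = u (∑ i, B i ω) :=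
    hlB.mono fun ω h => (Filter.eventually_all.2 h).mono fun n hn => by simp only [hn]
  refine expect_le_of_cross hwA hwB (le_of_tendsto_of_tendsto'
    ((tendsto_expPos uA hK (hpA.mono fun ω h n => (hb _ _ (h n)).1) eA).add
      (tendsto_expNeg uB hK (hpB.mono fun ω h n => (hb _ _ (h n)).2) eB))
    ((tendsto_expPos uB hK (hpB.mono fun ω h n => (hb _ _ (h n)).1) eB).add
      (tendsto_expNeg uA hK (hpA.mono fun ω h n => (hb _ _ (h n)).2) eA)) cross)

/-! ### The star case -/

/-- `M + s` and `M + t` are convex combinations of `M` and `M + (s + t)` with swapped weights. -/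
lemma _root_.ConvexOn.add_le_add_of_nonneg {u : ℝ → ℝ} (hu : ConvexOn ℝ Set.univ u) (M : ℝ)
    {s t : ℝ} (hs : 0 ≤ s) (ht : 0 ≤ t) : u (M + s) + u (M + t) ≤ u M + u (M + (s + t)) := by
  rcases (add_nonneg hs ht).eq_or_lt with h | h
  · have h1 : s = 0 := by linarith
    have h2 : t = 0 := by linarith
    simp [h1, h2]
  · have h1 := hu.2 (Set.mem_univ M) (Set.mem_univ (M + (s + t)))
      (show 0 ≤ t / (s + t) by positivity) (show 0 ≤ s / (s + t) by positivity)
      (by field_simp; ring)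
    have h2 := hu.2 (Set.mem_univ M) (Set.mem_univ (M + (s + t)))
      (show 0 ≤ s / (s + t) by positivity) (show 0 ≤ t / (s + t) by positivity)
      (by field_simp)
    have e1 : (t / (s + t)) • M + (s / (s + t)) • (M + (s + t)) = M + s := by
      simp only [smul_eq_mul]; field_simp; ring
    have e2 : (s / (s + t)) • M + (t / (s + t)) • (M + (s + t)) = M + t := by
      simp only [smul_eq_mul]; field_simp; ring
    rw [e1] at h1
    rw [e2] at h2
    have e3 : (t / (s + t)) • u M + (s / (s + t)) • u (M + (s + t)) +
        ((s / (s + t)) • u M + (t / (s + t)) • u (M + (s + t))) = u M + u (M + (s + t)) := by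
      simp only [smul_eq_mul]; field_simp; ring
    linarith

lemma _root_.ConvexOn.sum_le_of_nonneg {ι : Type*} {u : ℝ → ℝ} (hu : ConvexOn ℝ Set.univ u)
    (M : ℝ) (s : Finset ι) {δ : ι → ℝ} (hδ : ∀ i, 0 ≤ δ i) :
    ∑ i ∈ s, (u (M + δ i) - u M) + u M ≤ u (M + ∑ i ∈ s, δ i) := by
  classical
  induction s using Finset.induction_on with
  | empty => simp
  | insert i s hi ih =>
    rw [Finset.sum_insert hi, Finset.sum_insert hi]
    have := hu.add_le_add_of_nonneg M (hδ i) (Finset.sum_nonneg fun j (_ : j ∈ s) => hδ j)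
    linarith

lemma sum_comp_sub_of_single {ι : Type*} [Fintype ι] (u : ℝ → ℝ) (M : ℝ) {δ : ι → ℝ}
    (hδ : ∀ i j, i ≠ j → δ i = 0 ∨ δ j = 0) :
    ∑ i, (u (M + δ i) - u M) + u M = u (M + ∑ i, δ i) := by
  by_cases h : ∃ i, δ i ≠ 0
  · obtain ⟨i, hi⟩ := h
    have h0 : ∀ j, j ≠ i → δ j = 0 := fun j hj => (hδ i j hj.symm).resolve_left hi
    rw [Fintype.sum_eq_single i fun j hj => by simp [h0 j hj], Fintype.sum_eq_single i h0]
    ring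
  · push Not at h
    simp [h]

/-- The lower bounds pass to `B` through the marginals; the potentials are tight along `A` because
at most one summand exceeds its bound. -/
lemma convexOrder_of_lowerStar {Ω Ω' ι : Type*} [Fintype ι] [MeasurableSpace Ω]
    [MeasurableSpace Ω'] {P : Measure Ω} [IsProbabilityMeasure P] {P' : Measure Ω'}
    [IsProbabilityMeasure P'] {A : ι → Ω' → ℝ} {B : ι → Ω → ℝ}
    (hAB : ∀ i, IdentDistrib (A i) (B i) P' P) {m : ι → ℝ}
    (hA : ∀ᵐ ω ∂P', (∀ i, m i ≤ A i ω) ∧ ∀ i j, i ≠ j → A i ω = m i ∨ A j ω = m j) :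
    ConvexOrder P' P (fun ω => ∑ i, A i ω) (fun ω => ∑ i, B i ω) := by
  intro u hu hwA hwB
  have hB : ∀ᵐ ω ∂P, ∀ i, m i ≤ B i ω := ae_all_iff.2 fun i =>
    (hAB i).ae_mem_snd measurableSet_Ici (hA.mono fun ω h => h.1 i)
  set φ : ℕ → ι → ℝ → ℝ := fun n i x => max (m i) (min x (m i + n)) with hφ
  have lo : ∀ n i x, m i ≤ φ n i x := fun n i x => le_max_left _ _
  have hi : ∀ n i x, φ n i x ≤ m i + n := fun n i x =>
    max_le (by linarith [Nat.cast_nonneg (α := ℝ) n]) (min_le_right _ _)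
  have path : ∀ x : ι → ℝ, (∀ i, m i ≤ x i) → ∀ n,
      ∑ i, φ n i (x i) ∈ Set.uIcc (∑ i, m i) (∑ i, x i) := fun x hx n =>
    Set.mem_uIcc.2 (Or.inl ⟨Finset.sum_le_sum fun i _ => lo n i _,
      Finset.sum_le_sum fun i _ => max_le (hx i) (min_le_left _ _)⟩)
  have lim : ∀ x : ι → ℝ, (∀ i, m i ≤ x i) → ∀ i, ∀ᶠ n in Filter.atTop, φ n i (x i) = x i := by
    intro x hx i
    obtain ⟨N, hN⟩ := exists_nat_ge (x i - m i)
    filter_upwards [Filter.eventually_ge_atTop N] with n hn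
    have : (N : ℝ) ≤ n := by exact_mod_cast hn
    simp only [hφ]
    rw [min_eq_left (by linarith), max_eq_right (hx i)]
  have split : ∀ n (x : ι → ℝ), ∑ i, φ n i (x i) = ∑ i, m i + ∑ i, (φ n i (x i) - m i) := by
    intro n x
    rw [Finset.sum_sub_distrib]; ring
  refine expect_le_of_truncated_potentials hAB hu (c := ∑ i, m i) (φ := φ)
    (fun n i => by fun_prop) (fun n => ⟨fun i => |m i| + n, fun i x => ?_⟩)
    (hA.mono fun ω h => path _ h.1) (hB.mono fun ω h => path _ h)
    (hA.mono fun ω h => lim _ h.1) (hB.mono fun ω h => lim _ h) (fun n => ?_) hwA hwB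
  · have := lo n i x
    have := hi n i x
    have := Nat.cast_nonneg (α := ℝ) n
    exact abs_le.2 ⟨by linarith [neg_abs_le (m i)], by linarith [le_abs_self (m i)]⟩
  · have cu := hu.continuous_of_univ
    refine ⟨fun i x => u (∑ j, m j + (x - m i)) - u (∑ j, m j), u (∑ j, m j),
      fun i => by fun_prop, fun x => ?_, hA.mono fun ω h => ?_⟩
    · rw [split]
      exact hu.sum_le_of_nonneg _ _ fun i => sub_nonneg.2 (lo n i _)
    · rw [split]
      refine sum_comp_sub_of_single u _ fun i j hij => ?_
      have e : ∀ i, A i ω = m i → φ n i (A i ω) - m i = 0 := by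
        intro i hi
        simp [hφ, hi]
      exact (h.2 i j hij).imp (e i) (e j)

/-! ### The case of two varying coordinates -/

/-- Clamping is odd, monotone and 1-Lipschitz; compare `x` with `-y`. With three summands this
fails. -/
lemma clamp_add_clamp_mem_uIcc {n : ℝ} (hn : 0 ≤ n) (x y : ℝ) :
    max (-n) (min x n) + max (-n) (min y n) ∈ Set.uIcc 0 (x + y) := by
  rw [Set.mem_uIcc]
  rcases le_total x n with h1 | h1 <;> rcases le_total y n with h2 | h2 <;>
  rcases le_total x (-n) with h3 | h3 <;> rcases le_total y (-n) with h4 | h4 <;>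
  rcases le_total 0 (x + y) with h5 | h5 <;> grind

lemma convexOrder_of_antitone_pair {Ω Ω' : Type*} [MeasurableSpace Ω]
    [MeasurableSpace Ω'] {P : Measure Ω} [IsProbabilityMeasure P] {P' : Measure Ω'}
    [IsProbabilityMeasure P'] {A₁ A₂ : Ω' → ℝ} {B₁ B₂ : Ω → ℝ}
    (h₁ : IdentDistrib A₁ B₁ P' P) (h₂ : IdentDistrib A₂ B₂ P' P) {G : Set Ω'}
    (hG : ∀ᵐ ω ∂P', ω ∈ G)
    (hA : ∀ ω ∈ G, ∀ ω' ∈ G, A₁ ω < A₁ ω' → A₂ ω' ≤ A₂ ω) :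
    ConvexOrder P' P (fun ω => A₁ ω + A₂ ω) (fun ω => B₁ ω + B₂ ω) := by
  intro u hu hwA hwB
  set φ : ℕ → ℝ → ℝ := fun n x => max (-(n : ℝ)) (min x n) with hφ
  have mono : ∀ n, Monotone (φ n) := fun n x y h => max_le_max le_rfl (min_le_min h le_rfl)
  have mem : ∀ (n : ℕ) x, φ n x ∈ Set.Icc (-(n : ℝ)) n := fun n x =>
    ⟨le_max_left _ _, max_le (by linarith [Nat.cast_nonneg (α := ℝ) n]) (min_le_right _ _)⟩
  have lim : ∀ x, ∀ᶠ n in Filter.atTop, φ n x = x := by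
    intro x
    obtain ⟨N, hN⟩ := exists_nat_ge |x|
    filter_upwards [Filter.eventually_ge_atTop N] with n hn
    have : (N : ℝ) ≤ n := by exact_mod_cast hn
    simp only [hφ]
    rw [min_eq_left (by linarith [le_abs_self x]), max_eq_right (by linarith [neg_abs_le x])]
  have key := expect_le_of_truncated_potentials (P := P) (P' := P') (ι := Fin 2)
    (A := ![A₁, A₂]) (B := ![B₁, B₂]) (by simpa [Fin.forall_fin_two] using ⟨h₁, h₂⟩) hu (c := 0)
    (φ := fun n _ => φ n) (fun n i => by fun_prop)
    (fun n => ⟨fun _ => n, fun i x => abs_le.2 (mem n x)⟩)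
    (Filter.Eventually.of_forall fun ω n => by
      simpa [Fin.sum_univ_two] using clamp_add_clamp_mem_uIcc n.cast_nonneg (A₁ ω) (A₂ ω))
    (Filter.Eventually.of_forall fun ω n => by
      simpa [Fin.sum_univ_two] using clamp_add_clamp_mem_uIcc n.cast_nonneg (B₁ ω) (B₂ ω))
    (Filter.Eventually.of_forall fun ω i => lim _)
    (Filter.Eventually.of_forall fun ω i => lim _) ?_
    (by simpa [Fin.sum_univ_two] using hwA) (by simpa [Fin.sum_univ_two] using hwB)
  · simpa [Fin.sum_univ_two] using key
  · intro n
    -- Clamping is monotone, so the clamped support is still antitone.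
    obtain ⟨a, b, ha, hb, hle, heq⟩ := exists_potentials hu (N := n)
      (D := (fun ω => (φ n (A₁ ω), φ n (A₂ ω))) '' G)
      (by rintro _ ⟨ω, -, rfl⟩; exact ⟨mem n _, mem n _⟩)
      (by
        rintro _ ⟨ω, hω, rfl⟩ _ ⟨ω', hω', rfl⟩ h
        exact mono n (hA ω hω ω' hω' ((mono n).reflect_lt h)))
    refine ⟨![a, b], 0, by simpa [Fin.forall_fin_two] using ⟨ha, hb⟩, fun x => ?_, ?_⟩
    · simpa [Fin.sum_univ_two] using hle _ (mem n (x 0)) (φ n (x 1))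
    · filter_upwards [hG] with ω hω
      simpa [Fin.sum_univ_two] using heq _ ⟨ω, hω, rfl⟩

/-! ### Invariance of the convex order, and antitone supports -/

section ConvexOrder

variable {Ω Ω' : Type*} [MeasurableSpace Ω] [MeasurableSpace Ω'] {P : Measure Ω} {P' : Measure Ω'}

lemma expPos_congr_ae {V W : Ω → ℝ} (h : V =ᵐ[P] W) : expPos P V = expPos P W :=
  lintegral_congr_ae (h.mono fun ω hω => by simp only [hω])

lemma expNeg_congr_ae {V W : Ω → ℝ} (h : V =ᵐ[P] W) : expNeg P V = expNeg P W :=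
  lintegral_congr_ae (h.mono fun ω hω => by simp only [hω])

lemma ConvexOrder.congr_ae {X X' : Ω' → ℝ} {Y Y' : Ω → ℝ} (h : ConvexOrder P' P X Y)
    (hX : X =ᵐ[P'] X') (hY : Y =ᵐ[P] Y') : ConvexOrder P' P X' Y' := by
  intro u hu
  have h1 := h u hu
  have eX : (fun ω => u (X ω)) =ᵐ[P'] fun ω => u (X' ω) := hX.fun_comp u
  have eY : (fun ω => u (Y ω)) =ᵐ[P] fun ω => u (Y' ω) := hY.fun_comp u
  simpa only [ExpWellDefined, expect, expPos_congr_ae eX, expPos_congr_ae eY,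
    expNeg_congr_ae eX, expNeg_congr_ae eY] using h1

lemma ConvexOrder.const_add {X : Ω' → ℝ} {Y : Ω → ℝ} (h : ConvexOrder P' P X Y) (c : ℝ) :
    ConvexOrder P' P (fun ω => c + X ω) (fun ω => c + Y ω) := by
  intro u hu
  have := hu.translate_right c
  rw [Set.preimage_univ] at this
  exact h _ this

lemma ConvexOrder.of_neg {X : Ω' → ℝ} {Y : Ω → ℝ}
    (h : ConvexOrder P' P (fun ω => -X ω) (fun ω => -Y ω)) : ConvexOrder P' P X Y := by
  intro u hu
  have hneg : ConvexOn ℝ Set.univ (fun x => u (-x)) := by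
    exact hu.comp_linearMap (-LinearMap.id)
  simpa only [neg_neg] using h _ hneg

lemma _root_.ProbabilityTheory.IdentDistrib.convexOrder {X : Ω' → ℝ} {Y : Ω → ℝ}
    (h : IdentDistrib X Y P' P) : ConvexOrder P' P X Y := by
  intro u hu _ _
  have hm := hu.continuous_of_univ.measurable
  have e1 : expPos P' (fun ω => u (X ω)) = expPos P (fun ω => u (Y ω)) :=
    (h.comp (hm.max measurable_const).ennreal_ofReal).lintegral_eq
  have e2 : expNeg P' (fun ω => u (X ω)) = expNeg P (fun ω => u (Y ω)) :=
    (h.comp (hm.neg.max measurable_const).ennreal_ofReal).lintegral_eq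
  rw [expect, expect, e1, e2]

lemma CounterMonotonic.exists_antitone {X Y : Ω → ℝ} (h : CounterMonotonic P X Y) :
    ∃ G : Set Ω, (∀ᵐ ω ∂P, ω ∈ G) ∧ ∀ ω ∈ G, ∀ ω' ∈ G, X ω < X ω' → Y ω' ≤ Y ω := by
  obtain ⟨Z, f, g, -, hf, hg, hX, hY⟩ := h
  refine ⟨{ω | X ω = f (Z ω) ∧ -Y ω = g (Z ω)}, hX.and hY, ?_⟩
  rintro ω ⟨h1, h2⟩ ω' ⟨h3, h4⟩ hlt
  rw [h1, h3] at hlt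
  have := hg (hf.reflect_lt hlt).le
  linarith

lemma exists_pairwiseAntitone {ι : Type*} [Countable ι] {V : ι → Ω → ℝ}
    (h : ∀ i j, i ≠ j → CounterMonotonic P (V i) (V j)) :
    ∃ G : Set Ω, (∀ᵐ ω ∂P, ω ∈ G) ∧ PairwiseAntitone ((fun ω i => V i ω) '' G) := by
  choose G hG hG' using fun i j hij => (h i j hij).exists_antitone
  refine ⟨{ω | ∀ i j hij, ω ∈ G i j hij},
    ae_all_iff.2 fun i => ae_all_iff.2 fun j => ae_all_iff.2 fun hij => hG i j hij, ?_⟩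
  rintro _ ⟨ω, hω, rfl⟩ _ ⟨ω', hω', rfl⟩ i j hij hlt
  exact hG' i j hij ω (hω i j hij) ω' (hω' i j hij) hlt

end ConvexOrder

end CxOrder

/-! ### The theorem -/

theorem theorem6 {Ω Ω' : Type*} [MeasurableSpace Ω] [MeasurableSpace Ω']
    (P : Measure Ω) [IsProbabilityMeasure P] (P' : Measure Ω') [IsProbabilityMeasure P']
    (d : ℕ) (X : Fin d → Ω → ℝ) (hX : ∀ i, AEMeasurable (X i) P)
    (Xct : Fin d → Ω' → ℝ) (hct : CxOrder.IsCounterMonotonicVersion P' P Xct X) :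
    CxOrder.ConvexOrder P' P (fun ω => ∑ i, Xct i ω) (fun ω => ∑ i, X i ω) := by
  obtain ⟨hcm, hid⟩ := hct
  match d with
  | 0 =>
    refine IdentDistrib.convexOrder ⟨by simp, by simp, ?_⟩
    simp [Measure.map_const]
  | 1 => simpa using (hid 0).convexOrder
  | d + 2 =>
    obtain ⟨G, hG, hanti⟩ := CxOrder.exists_pairwiseAntitone hcm
    rcases hanti.classification with ⟨i, j, hij, hconst⟩ | ⟨m, hm⟩ | ⟨m, hm⟩
    · obtain ⟨ω₀, hω₀⟩ := hG.exists
      have cA : ∀ᵐ ω ∂P', ∀ l, l ≠ i → l ≠ j → Xct l ω = Xct l ω₀ :=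
        hG.mono fun ω hω l hi hj => hconst l hi hj _ ⟨ω, hω, rfl⟩ _ ⟨ω₀, hω₀, rfl⟩
      -- A variable with the law of a constant is almost surely that constant.
      have cB : ∀ᵐ ω ∂P, ∀ l, l ≠ i → l ≠ j → X l ω = Xct l ω₀ :=
        ae_all_iff.2 fun l => ae_all_iff.2 fun hi => ae_all_iff.2 fun hj =>
          (hid l).ae_mem_snd (measurableSet_singleton (Xct l ω₀))
            (cA.mono fun ω h => h l hi hj)
      have sum_eq : ∀ x : Fin (d + 2) → ℝ, (∀ l, l ≠ i → l ≠ j → x l = Xct l ω₀) →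
          (∑ l ∈ (Finset.univ.erase i).erase j, Xct l ω₀) + (x i + x j) = ∑ l, x l := by
        intro x hx
        rw [← Finset.add_sum_erase Finset.univ x (Finset.mem_univ i),
          ← Finset.add_sum_erase _ x (Finset.mem_erase.2 ⟨hij.symm, Finset.mem_univ j⟩),
          Finset.sum_congr rfl fun l hl => (hx l (Finset.ne_of_mem_erase
            (Finset.mem_of_mem_erase hl)) (Finset.ne_of_mem_erase hl)).symm]
        ring
      refine ((CxOrder.convexOrder_of_antitone_pair (hid i) (hid j) hG ?_).const_add
        (∑ l ∈ (Finset.univ.erase i).erase j, Xct l ω₀)).congr_ae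
        (cA.mono fun ω h => sum_eq _ h) (cB.mono fun ω h => sum_eq _ h)
      exact fun ω hω ω' hω' => hanti _ ⟨ω, hω, rfl⟩ _ ⟨ω', hω', rfl⟩ i j hij
    · exact CxOrder.convexOrder_of_lowerStar hid (hG.mono fun ω hω => hm _ ⟨ω, hω, rfl⟩)
    · refine CxOrder.ConvexOrder.of_neg ?_
      simp only [← Finset.sum_neg_distrib]
      refine CxOrder.convexOrder_of_lowerStar (A := fun i ω => -Xct i ω) (B := fun i ω => -X i ω)
        (fun i => (hid i).comp measurable_neg) (hG.mono fun ω hω => ?_) (m := m)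
      exact hm (fun i => -Xct i ω) ⟨ω, hω, by ext i; simp⟩
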